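/- Conventions. Let $(\Omega,\mathcal F,\mathbb P)$ be a probability space, $B$ a separable real Banach space and $(\mathcal F_i)_{i\ge 0}$ a non-decreasing sequence of sub-$\sigma$-algebras of $\mathcal F$ (the $\sigma$-algebra $\mathcal F_0\subseteq\mathcal F_1$ is arbitrary, for instance trivial). A sequence $(X_i,\mathcal F_i)_{i\ge1}$ of $B$-valued random variables is a sequence of martingale differences if, for every $i\ge1$, $X_i$ is $\mathcal F_i$-measurable with $\mathbb E\|X_i\|<\infty$, and, for every $i\ge2$, $\mathbb E[X_i\mid\mathcal F_{i-1}]=0$ almost surely. Put $S_k=\sum_{i=1}^kX_i$. For $1<r\le2$, $B$ is $r$-smooth if there is an equivalent norm $\|\cdot\|'$ on $B$ with $$\sup_{t>0}\frac1{t^r}\sup\{\|x+ty\|'+\|x-ty\|'-2:\ \|x\|'=\|y\|'=1\}<\infty .$$ For $D>0$, $B$ is $(r,D)$-smooth if it is $r$-smooth and $\mathbb E\big\|\sum_{i=1}^nX_i\big\|^r\le D\sum_{i=1}^n\mathbb E\|X_i\|^r$ for all $n\ge1$ and all $B$-valued martingale difference sequences (on any probability space). Theorem. Let $1<r\le2$,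 $D>0$, let $B$ be an $(r,D)$-smooth separable Banach space and let $p_2\ge p_1>r$. Let $(X_i,\mathcal F_i)_{i\ge1}$ be a sequence of $B$-valued martingale differences such that $$\sup_{i\ge1}\sup_{t>0}t^{p_1}\,\mathbb P(\|X_i\|>t)\le C_1\quad\text{and}\quad \sup_{i\ge1}\sup_{t>0}t^{p_2}\,\mathbb P\Big(\big(\mathbb E[\|X_i\|^r\mid\mathcal F_{i-1}]\big)^{1/r}>t\Big)\le C_2$$ for some constants $C_1,C_2$. Then, for all $n\ge1$ and all $x>0$, $$\mathbb P\Big(\max_{1\le k\le n}\|S_k\|>nx\Big)\le K_1\,C_1\,x^{-p_1}\frac1{n^{p_1-1}}+K_2\,C_2\,x^{-p_2}\frac1{n^{p_2-p_2/r}},$$ where $$K_1=\frac{2^{2p_2}}{2^{2p_2}-1}\,2^{1-r}\,2^{p_1+2p_1p_2/r}\,D^{p_1/r},\qquad K_2=\frac{2^{2p_2}}{2^{2p_2}-1}\,2^{1-r}\,2^{p_2+2p_2^2/r}\,D^{p_2/r}\Big(\frac{p_2}{p_2-r}\Big)^{p_2/r}$$ do not depend on $n$ or $x$. In particular, as $n\to\infty$,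 $$\mathbb P\Big(\max_{1\le k\le n}\|S_k\|>n\Big)=O\Big(\frac1{n^{\min\{p_1-1,\;p_2-p_2/r\}}}\Big).$$ -/

import Mathlib

open MeasureTheory Filter Asymptotics

open scoped NNReal ENNReal

universe u v

/-- `(X i, F i)`, `i ≥ 1`, is a sequence of `B`-valued martingale differences: `X i` is
`F i`-measurable and integrable for `i ≥ 1`, and `E[X i | F (i - 1)] = 0` a.s. for `i ≥ 2`.
The value `X 0` is irrelevant. For a separable space `B`, strong measurability is the same as
Borel measurability. -/
structure IsMartingaleDiff {Ω : Type u} {B : Type v} [NormedAddCommGroup B] [NormedSpace ℝ B]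
    [CompleteSpace B] {mΩ : MeasurableSpace Ω} (P : Measure Ω) (F : Filtration ℕ mΩ)
    (X : ℕ → Ω → B) : Prop where
  stronglyMeasurable : ∀ i, 1 ≤ i → StronglyMeasurable[F i] (X i)
  integrable : ∀ i, 1 ≤ i → Integrable (X i) P
  condExp_eq_zero : ∀ i, 2 ≤ i → P[X i | F (i - 1)] =ᵐ[P] 0

/-- The partial sum `S_k = X_1 + ⋯ + X_k`. -/
def partialSum {Ω : Type u} {B : Type v} [NormedAddCommGroup B] (X : ℕ → Ω → B) (k : ℕ)
    (ω : Ω) : B :=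
  ∑ i ∈ Finset.Icc 1 k, X i ω

/-- `max_{1 ≤ k ≤ n} ‖S_k‖` (equal to `0` for `n = 0`). -/
def maxNorm {Ω : Type u} {B : Type v} [NormedAddCommGroup B] (X : ℕ → Ω → B) (n : ℕ)
    (ω : Ω) : ℝ≥0 :=
  (Finset.Icc 1 n).sup fun k => ‖partialSum X k ω‖₊

/-- `B` is `r`-smooth: for some equivalent norm `N`,
`sup_{t > 0} t^{-r} sup {N (x + t y) + N (x - t y) - 2 : N x = N y = 1} < ∞`.
A seminorm that is bounded below by a positive multiple of the norm is a norm. -/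
def IsRSmooth (B : Type v) [NormedAddCommGroup B] [NormedSpace ℝ B] (r : ℝ) : Prop :=
  ∃ N : Seminorm ℝ B,
    (∃ c C : ℝ, 0 < c ∧ 0 < C ∧ ∀ x : B, c * ‖x‖ ≤ N x ∧ N x ≤ C * ‖x‖) ∧
    ∃ M : ℝ, ∀ t : ℝ, 0 < t → ∀ x y : B, N x = 1 → N y = 1 →
      1 / t ^ r * (N (x + t • y) + N (x - t • y) - 2) ≤ M

/-- `B` is `(r, D)`-smooth: `1 < r ≤ 2`, `D > 0`, `B` is `r`-smooth, and
`E ‖X_1 + ⋯ + X_n‖ ^ r ≤ D (E ‖X_1‖ ^ r + ⋯ + E ‖X_n‖ ^ r)` for all `B`-valued martingale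
difference sequences, on all probability spaces (expectations in `[0, ∞]`). -/
structure IsRDSmooth (B : Type v) [NormedAddCommGroup B] [NormedSpace ℝ B] [CompleteSpace B]
    (r D : ℝ) : Prop where
  one_lt : 1 < r
  le_two : r ≤ 2
  pos : 0 < D
  smooth : IsRSmooth B r
  moment_le : ∀ (Ω : Type u) (mΩ : MeasurableSpace Ω) (P : Measure Ω) (_ : IsProbabilityMeasure P)
    (F : Filtration ℕ mΩ) (X : ℕ → Ω → B), IsMartingaleDiff P F X → ∀ n : ℕ, 1 ≤ n →
      ∫⁻ ω, ‖partialSum X n ω‖ₑ ^ r ∂P ≤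
        ENNReal.ofReal D * ∑ i ∈ Finset.Icc 1 n, ∫⁻ ω, ‖X i ω‖ₑ ^ r ∂P

/-- The constant `K_1(p_1, p_2, r, D)`. -/
noncomputable def constK1 (p₁ p₂ r D : ℝ) : ℝ :=
  (2 : ℝ) ^ (2 * p₂) / ((2 : ℝ) ^ (2 * p₂) - 1) * (2 : ℝ) ^ (1 - r) *
    (2 : ℝ) ^ (p₁ + 2 * p₁ * p₂ / r) * D ^ (p₁ / r)

/-- The constant `K_2(p_1, p_2, r, D)`; it does not involve `p_1`. -/
noncomputable def constK2 (p₂ r D : ℝ) : ℝ :=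
  (2 : ℝ) ^ (2 * p₂) / ((2 : ℝ) ^ (2 * p₂) - 1) * (2 : ℝ) ^ (1 - r) *
    (2 : ℝ) ^ (p₂ + 2 * p₂ ^ 2 / r) * D ^ (p₂ / r) * (p₂ / (p₂ - r)) ^ (p₂ / r)

/-! The proof compares the tail f(l) = P(max ‖S_k‖ > l) at the levels 2l and l. Keep only the
increments of S between its first passage above l and its first passage above 2l. If every increment
is at most l/2, S enters at norm at most 3l/2, so the kept increments must add up to more than l/2
before 2l is passed. Markov's inequality and (r, D)-smoothness bound this event by the r-th moments
of the kept increments. Whether the i-th increment is kept is known at time i - 1, so its r-th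
moment is the integral of E[‖X_i‖^r | F_{i-1}] over an event of probability at most f(l). Truncating
at a height s gives s f(l) plus a tail term of order s^(1 - p₂/r). With s proportional to l^r / n
this yields f(2l) ≤ A f(l) + b₁ l^(-p₁) + b₂ l^(-p₂), where A 2^p₂ = 1/2. Iterating over l/2, l/4, …
and setting l = nx gives the rates, with constants below the stated ones. -/

/-- If `V` has a tail of order `u ^ (-q)` with `1 < q`, then its integral over a set `E` is at most
`s P(E)` plus the integral of the tail beyond the level `s`. -/
theorem setLIntegral_ofReal_le_of_tail {Ω : Type*} {mΩ : MeasurableSpace Ω} (P : Measure Ω)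
    [IsFiniteMeasure P] {V : Ω → ℝ} (hV : AEMeasurable V P) {q C s : ℝ} (hq : 1 < q) (hs : 0 < s)
    (hC : 0 ≤ C) (tail : ∀ u : ℝ, 0 < u → P.real {ω | u < V ω} ≤ C * u ^ (-q)) (E : Set Ω) :
    ∫⁻ ω in E, ENNReal.ofReal (V ω) ∂P ≤
      ENNReal.ofReal (s * P.real E + C * (s ^ (1 - q) / (q - 1))) := by
  have hint : IntegrableOn (fun t : ℝ => C * (t + s) ^ (-q)) (Set.Ioi 0) :=
    (integrableOn_add_rpow_Ioi_of_lt (by linarith) (by linarith)).const_mul C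
  have hval : ∫ t in Set.Ioi (0 : ℝ), C * (t + s) ^ (-q) = C * (s ^ (1 - q) / (q - 1)) := by
    rw [integral_const_mul]
    congr 1
    have h := (measurePreserving_add_right volume s).setIntegral_preimage_emb
      (measurableEmbedding_addRight s) (fun t : ℝ => t ^ (-q)) (Set.Ioi s)
    rw [Set.preimage_add_const_Ioi, sub_self] at h
    rw [h, integral_Ioi_rpow_of_lt (by linarith) hs,
      show -q + 1 = 1 - q by ring, show q - 1 = -(1 - q) by ring, div_neg, neg_div]
  have hlayer : ∫⁻ ω, ENNReal.ofReal (max (V ω - s) 0) ∂P ≤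
      ENNReal.ofReal (C * (s ^ (1 - q) / (q - 1))) := by
    rw [lintegral_eq_lintegral_meas_lt (f := fun ω => max (V ω - s) 0) P
      (Eventually.of_forall fun _ => le_max_right _ _)
      ((hV.sub_const s).max aemeasurable_const), ← hval,
      ofReal_integral_eq_lintegral_ofReal hint]
    · refine setLIntegral_mono_ae' measurableSet_Ioi (Eventually.of_forall fun t ht => ?_)
      have ht' : (0 : ℝ) < t := ht
      have hset : {ω | t < max (V ω - s) 0} = {ω | t + s < V ω} := by
        ext ω
        simp only [Set.mem_ofPred_eq, lt_max_iff, not_lt.2 ht'.le, or_false, lt_sub_iff_add_lt]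
      rw [hset, ← ofReal_measureReal]
      exact ENNReal.ofReal_le_ofReal (tail _ (by linarith))
    · refine (ae_restrict_iff' measurableSet_Ioi).2 (Eventually.of_forall fun t ht => ?_)
      have ht' : (0 : ℝ) < t := ht
      exact mul_nonneg hC (Real.rpow_nonneg (by linarith) _)
  calc ∫⁻ ω in E, ENNReal.ofReal (V ω) ∂P
      ≤ ∫⁻ ω in E, (ENNReal.ofReal s + ENNReal.ofReal (max (V ω - s) 0)) ∂P := by
        refine lintegral_mono fun ω => ?_
        rw [← ENNReal.ofReal_add hs.le (le_max_right _ _)]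
        exact ENNReal.ofReal_le_ofReal (by linarith [le_max_left (V ω - s) 0])
    _ = ENNReal.ofReal s * P E + ∫⁻ ω in E, ENNReal.ofReal (max (V ω - s) 0) ∂P := by
        rw [lintegral_add_left measurable_const, setLIntegral_const]
    _ ≤ ENNReal.ofReal s * P E + ENNReal.ofReal (C * (s ^ (1 - q) / (q - 1))) := by
        gcongr
        exact (setLIntegral_le_lintegral _ _).trans hlayer
    _ = _ := by
        rw [ENNReal.ofReal_add (by positivity), ENNReal.ofReal_mul hs.le, ofReal_measureReal]
        exact mul_nonneg hC (div_nonneg (Real.rpow_nonneg hs.le _) (by linarith))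

/-! ### Running maximum and increments between two passages -/

theorem partialSum_succ {Ω : Type*} {B : Type*} [NormedAddCommGroup B] (X : ℕ → Ω → B) (k : ℕ)
    (ω : Ω) : partialSum X (k + 1) ω = partialSum X k ω + X (k + 1) ω :=
  Finset.sum_Icc_succ_top (by omega) _

theorem maxNorm_succ {Ω : Type*} {B : Type*} [NormedAddCommGroup B] (X : ℕ → Ω → B) (k : ℕ)
    (ω : Ω) : (maxNorm X (k + 1) ω : ℝ) = max (maxNorm X k ω : ℝ) ‖partialSum X (k + 1) ω‖ := by
  have h : maxNorm X (k + 1) ω = maxNorm X k ω ⊔ ‖partialSum X (k + 1) ω‖₊ := by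
    unfold maxNorm
    rw [← Finset.insert_Icc_right_eq_Icc_add_one (by omega), Finset.sup_insert, sup_comm]
  rw [h, NNReal.coe_max, coe_nnnorm]

theorem maxNorm_zero {Ω : Type*} {B : Type*} [NormedAddCommGroup B] (X : ℕ → Ω → B) (ω : Ω) :
    maxNorm X 0 ω = 0 := by
  simp [maxNorm]

theorem norm_partialSum_le_maxNorm {Ω : Type*} {B : Type*} [NormedAddCommGroup B]
    (X : ℕ → Ω → B) (k : ℕ) (ω : Ω) : ‖partialSum X k ω‖ ≤ maxNorm X k ω := by
  cases k with
  | zero => simp [partialSum]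
  | succ k => rw [maxNorm_succ]; exact le_max_right _ _

theorem maxNorm_mono {Ω : Type*} {B : Type*} [NormedAddCommGroup B] (X : ℕ → Ω → B) (ω : Ω) :
    Monotone fun k => maxNorm X k ω := fun _ _ h =>
  Finset.sup_mono (Finset.Icc_subset_Icc_right h)

/-- The event that the running maximum of `‖S_k‖` before time `i` lies in `(l, 2l]`. -/
def crossingSet {Ω : Type u} {B : Type v} [NormedAddCommGroup B] (X : ℕ → Ω → B) (l : ℝ) (i : ℕ) :
    Set Ω :=
  {ω | l < (maxNorm X (i - 1) ω : ℝ) ∧ (maxNorm X (i - 1) ω : ℝ) ≤ 2 * l}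

/-- The increments of `S` between the first passage of `‖S‖` above `l` and that above `2l`. -/
noncomputable def crossingDiff {Ω : Type u} {B : Type v} [NormedAddCommGroup B] (X : ℕ → Ω → B)
    (l : ℝ) (i : ℕ) : Ω → B :=
  (crossingSet X l i).indicator (X i)

theorem lt_norm_partialSum_crossingDiff {Ω : Type*} {B : Type*} [NormedAddCommGroup B]
    (X : ℕ → Ω → B) {l : ℝ} (hl : 0 < l) {n : ℕ} {ω : Ω}
    (hX : ∀ i, 1 ≤ i → i ≤ n → ‖X i ω‖ ≤ l / 2) (hM : 2 * l < maxNorm X n ω) :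
    l / 2 < ‖partialSum (crossingDiff X l) n ω‖ := by
  -- Three regimes of the running maximum: nothing kept yet; the kept sum differs from S by its
  -- entry position, of norm at most l + l/2; the kept sum frozen once 2l is passed, where its norm
  -- exceeds 2l - 3l/2. A jump from below l to above 2l is excluded since 3l/2 < 2l.
  have key : ∀ m, m ≤ n →
      ((maxNorm X m ω : ℝ) ≤ l → partialSum (crossingDiff X l) m ω = 0) ∧
      (l < (maxNorm X m ω : ℝ) → (maxNorm X m ω : ℝ) ≤ 2 * l →
        ‖partialSum X m ω - partialSum (crossingDiff X l) m ω‖ ≤ 3 * l / 2) ∧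
      (2 * l < (maxNorm X m ω : ℝ) → l / 2 < ‖partialSum (crossingDiff X l) m ω‖) := by
    intro m
    induction m with
    | zero =>
      intro _
      simp only [maxNorm_zero, NNReal.coe_zero]
      exact ⟨fun _ => by simp [partialSum], fun h => absurd h (by linarith),
        fun h => absurd h (by linarith)⟩
    | succ m ih =>
      intro hm
      obtain ⟨ih1, ih2, ih3⟩ := ih (by omega)
      have hx := hX (m + 1) (by omega) hm
      have hS := norm_partialSum_le_maxNorm X m ω
      have hS1 : ‖partialSum X (m + 1) ω‖ ≤ ‖partialSum X m ω‖ + ‖X (m + 1) ω‖ := by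
        rw [partialSum_succ]; exact norm_add_le _ _
      have hmax := maxNorm_succ X m ω
      rw [partialSum_succ (crossingDiff X l)]
      rcases le_or_gt (maxNorm X m ω : ℝ) l with h | h
      · have hY : crossingDiff X l (m + 1) ω = 0 :=
          Set.indicator_of_notMem (fun hc => absurd hc.1 (not_lt.2 h)) _
        have hle : (maxNorm X (m + 1) ω : ℝ) ≤ 3 * l / 2 := by
          rw [hmax]; exact max_le (by linarith) (by linarith)
        rw [hY, ih1 h, add_zero, sub_zero]
        exact ⟨fun _ => rfl, fun _ _ => by linarith, fun hc => by linarith⟩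
      · have hmono : (maxNorm X m ω : ℝ) ≤ maxNorm X (m + 1) ω := by
          rw [hmax]; exact le_max_left _ _
        refine ⟨fun hc => by linarith, ?_⟩
        rcases le_or_gt (maxNorm X m ω : ℝ) (2 * l) with h2 | h2
        · have hY : crossingDiff X l (m + 1) ω = X (m + 1) ω :=
            Set.indicator_of_mem (show ω ∈ crossingSet X l (m + 1) from ⟨h, h2⟩) _
          have hd := ih2 h h2
          have hd' : ‖partialSum X (m + 1) ω -
              (partialSum (crossingDiff X l) m ω + X (m + 1) ω)‖ ≤ 3 * l / 2 := by
            rwa [partialSum_succ, add_sub_add_right_eq_sub]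
          rw [hY]
          refine ⟨fun _ _ => hd', fun hc => ?_⟩
          have hbig : 2 * l < ‖partialSum X (m + 1) ω‖ := by
            rw [hmax, lt_max_iff] at hc
            exact hc.resolve_left (not_lt.2 h2)
          have := norm_sub_norm_le (partialSum X (m + 1) ω)
            (partialSum (crossingDiff X l) m ω + X (m + 1) ω)
          linarith
        · have hY : crossingDiff X l (m + 1) ω = 0 :=
            Set.indicator_of_notMem (fun hc => absurd hc.2 (not_le.2 h2)) _
          rw [hY, add_zero]
          exact ⟨fun _ hc => by linarith, fun _ => ih3 h2⟩
  exact (key n le_rfl).2.2 hM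

/-! ### Stopped martingale differences and the maximal inequality -/

section MartingaleDiff

variable {Ω : Type u} {B : Type v} [NormedAddCommGroup B] [NormedSpace ℝ B] [CompleteSpace B]
  {mΩ : MeasurableSpace Ω} {P : Measure Ω} {F : Filtration ℕ mΩ} {X : ℕ → Ω → B}

theorem IsMartingaleDiff.measurable_maxNorm (hX : IsMartingaleDiff P F X) (k : ℕ) :
    Measurable[F k] (fun ω => (maxNorm X k ω : ℝ)) := by
  induction k with
  | zero => simp only [maxNorm_zero]; exact measurable_const
  | succ k ih =>
    simp only [maxNorm_succ]
    refine Measurable.max (ih.mono (F.mono (Nat.le_succ k)) le_rfl) ?_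
    refine StronglyMeasurable.measurable (StronglyMeasurable.norm ?_)
    unfold partialSum
    refine Finset.stronglyMeasurable_fun_sum _ fun i hi => ?_
    rw [Finset.mem_Icc] at hi
    exact (hX.stronglyMeasurable i hi.1).mono (F.mono hi.2)

theorem IsMartingaleDiff.measurableSet_crossingSet (hX : IsMartingaleDiff P F X) (l : ℝ) (i : ℕ) :
    MeasurableSet[F (i - 1)] (crossingSet X l i) :=
  MeasurableSet.inter (measurableSet_lt measurable_const (hX.measurable_maxNorm _))
    (measurableSet_le (hX.measurable_maxNorm _) measurable_const)

/-- The selecting event involves the maximum only up to time i - 1, so its indicator is predictable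
and leaves the conditional expectation. -/
theorem IsMartingaleDiff.isMartingaleDiff_crossingDiff (hX : IsMartingaleDiff P F X) (l : ℝ) :
    IsMartingaleDiff P F (crossingDiff X l) where
  stronglyMeasurable i hi := (hX.stronglyMeasurable i hi).indicator
    (F.mono (Nat.sub_le i 1) _ (hX.measurableSet_crossingSet l i))
  integrable i hi := (hX.integrable i hi).indicator
    (F.le _ _ (hX.measurableSet_crossingSet l i))
  condExp_eq_zero i hi := by
    refine (condExp_indicator (hX.integrable i (by omega))
      (hX.measurableSet_crossingSet l i)).trans ?_
    filter_upwards [hX.condExp_eq_zero i hi] with ω hω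
    simp only [Set.indicator, hω, Pi.zero_apply, ite_self]

/-- A space that carries a nonzero vector can only be `(r, D)`-smooth with `1 ≤ D`. -/
theorem IsRDSmooth.one_le [IsProbabilityMeasure P] [Nontrivial B] {r D : ℝ}
    (hB : IsRDSmooth.{u, v} B r D) (F : Filtration ℕ mΩ) : 1 ≤ D := by
  obtain ⟨v, hv⟩ := exists_ne (0 : B)
  have hY : IsMartingaleDiff P F (fun i _ => if i = 1 then v else 0) :=
    { stronglyMeasurable := fun i _ => stronglyMeasurable_const
      integrable := fun i _ => integrable_const _
      condExp_eq_zero := fun i hi => by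
        rw [show (fun _ : Ω => if i = 1 then v else 0) = 0 by
          funext; simp [show i ≠ 1 by omega]]
        rw [condExp_zero] }
  have h := hB.moment_le Ω mΩ P inferInstance F _ hY 1 le_rfl
  simp only [partialSum, Finset.Icc_self, Finset.sum_singleton, if_true, lintegral_const,
    measure_univ, mul_one] at h
  have hr : 0 < r := by linarith [hB.one_lt]
  have hv0 : ‖v‖ₑ ^ r ≠ 0 := by
    simp [ENNReal.rpow_eq_zero_iff, hv]
  have hvt : ‖v‖ₑ ^ r ≠ ∞ := ENNReal.rpow_ne_top_of_nonneg hr.le enorm_ne_top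
  rw [← ENNReal.one_le_ofReal]
  by_contra hlt
  exact absurd h (not_le.2 (by
    simpa using ENNReal.mul_lt_mul_left hv0 hvt (not_le.1 hlt)))

theorem IsRDSmooth.measureReal_two_mul_lt_maxNorm_le [IsProbabilityMeasure P] {r D : ℝ}
    (hB : IsRDSmooth.{u, v} B r D) (hX : IsMartingaleDiff P F X) {n : ℕ} (hn : 1 ≤ n) {l a b : ℝ}
    (hl : 0 < l) (hb : 0 ≤ b) (ha : ∀ i, 1 ≤ i → P.real {ω | l / 2 < ‖X i ω‖} ≤ a)
    (hbY : ∀ i, 1 ≤ i → i ≤ n → ∫⁻ ω, ‖crossingDiff X l i ω‖ₑ ^ r ∂P ≤ ENNReal.ofReal b) :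
    P.real {ω | 2 * l < (maxNorm X n ω : ℝ)} ≤ n * a + D * (n * b) / (l / 2) ^ r := by
  have hr : 0 < r := by linarith [hB.one_lt]
  have hD := hB.pos
  have hl2 : 0 < l / 2 := by linarith
  set S := partialSum (crossingDiff X l) n with hS
  have hsub : {ω | 2 * l < (maxNorm X n ω : ℝ)} ⊆
      (⋃ i ∈ Finset.Icc 1 n, {ω | l / 2 < ‖X i ω‖}) ∪ {ω | l / 2 < ‖S ω‖} := by
    intro ω hω
    by_contra hc
    simp only [Set.mem_union, Set.mem_iUnion, Set.mem_ofPred_eq, not_or, not_exists,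
      Finset.mem_Icc] at hc
    exact hc.2 (lt_norm_partialSum_crossingDiff X hl
      (fun i h1 h2 => not_lt.1 (hc.1 i ⟨h1, h2⟩)) hω)
  have h1 : P.real (⋃ i ∈ Finset.Icc 1 n, {ω | l / 2 < ‖X i ω‖}) ≤ n * a := by
    refine (measureReal_biUnion_finset_le _ _).trans ?_
    refine (Finset.sum_le_card_nsmul _ _ a fun i hi => ha i (Finset.mem_Icc.1 hi).1).trans ?_
    simp
  have hmoment : ∫⁻ ω, ‖S ω‖ₑ ^ r ∂P ≤ ENNReal.ofReal (D * (n * b)) := by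
    refine (hB.moment_le Ω mΩ P inferInstance F _
      (hX.isMartingaleDiff_crossingDiff l) n hn).trans ?_
    rw [ENNReal.ofReal_mul hD.le]
    gcongr
    refine (Finset.sum_le_card_nsmul _ _ (ENNReal.ofReal b) fun i hi =>
      hbY i (Finset.mem_Icc.1 hi).1 (Finset.mem_Icc.1 hi).2).trans ?_
    rw [ENNReal.ofReal_mul (by positivity)]
    simp
  have h2 : P.real {ω | l / 2 < ‖S ω‖} ≤ D * (n * b) / (l / 2) ^ r := by
    have hSm : AEMeasurable (fun ω => ‖S ω‖ₑ ^ r) P := by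
      have : StronglyMeasurable S := by
        rw [hS]
        unfold partialSum
        refine Finset.stronglyMeasurable_fun_sum _ fun i hi => ?_
        exact ((hX.isMartingaleDiff_crossingDiff l).stronglyMeasurable i
          (Finset.mem_Icc.1 hi).1).mono (F.le i)
      exact (this.enorm.pow_const r).aemeasurable
    have hmk := mul_meas_ge_le_lintegral₀ hSm (ENNReal.ofReal ((l / 2) ^ r))
    rw [le_div_iff₀ (by positivity), mul_comm]
    have hle : ENNReal.ofReal ((l / 2) ^ r * P.real {ω | l / 2 < ‖S ω‖}) ≤
        ENNReal.ofReal (D * (n * b)) := by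
      rw [ENNReal.ofReal_mul (by positivity), ofReal_measureReal]
      refine le_trans ?_ (hmk.trans hmoment)
      gcongr
      rename_i ω
      intro hω
      rw [← ENNReal.ofReal_rpow_of_pos hl2, ← ofReal_norm]
      exact ENNReal.rpow_le_rpow (ENNReal.ofReal_le_ofReal (le_of_lt hω)) hr.le
    exact (ENNReal.ofReal_le_ofReal_iff (by positivity)).1 hle
  calc P.real {ω | 2 * l < (maxNorm X n ω : ℝ)}
      ≤ P.real _ + P.real _ := (measureReal_mono hsub).trans (measureReal_union_le _ _)
    _ ≤ _ := add_le_add h1 h2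

end MartingaleDiff

/-! ### Moments of the kept increments -/

/-- A tail bound for `V ^ (1 / r)`, at the power scale of `V`. -/
theorem measureReal_lt_le_of_rpow_tail {Ω : Type*} {mΩ : MeasurableSpace Ω} {P : Measure Ω}
    [IsFiniteMeasure P] {V : Ω → ℝ} {r p C : ℝ} (hr : 0 < r)
    (h : ∀ t : ℝ, 0 < t → t ^ p * P.real {ω | t < V ω ^ (1 / r)} ≤ C) {t : ℝ} (ht : 0 < t) :
    P.real {ω | t < V ω} ≤ C * t ^ (-(p / r)) := by
  have h1 := h (t ^ (1 / r)) (Real.rpow_pos_of_pos ht _)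
  rw [← Real.rpow_mul ht.le, one_div_mul_eq_div] at h1
  have h2 : P.real {ω | t < V ω} ≤ P.real {ω | t ^ (1 / r) < V ω ^ (1 / r)} :=
    measureReal_mono fun ω hω => Real.rpow_lt_rpow ht.le hω (by positivity)
  have h3 : 0 < t ^ (p / r) := Real.rpow_pos_of_pos ht _
  rw [Real.rpow_neg ht.le, ← div_eq_mul_inv, le_div_iff₀ h3, mul_comm]
  exact (mul_le_mul_of_nonneg_left h2 h3.le).trans h1

/-- Needed because `condExp` of a non-integrable function is 0 by default, which would make the
conditional moment meaningless. -/
theorem integrable_norm_rpow_of_tail {Ω B : Type*} [NormedAddCommGroup B]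
    {mΩ : MeasurableSpace Ω} {P : Measure Ω} [IsFiniteMeasure P] {Y : Ω → B}
    (hY : AEStronglyMeasurable Y P) {r p C : ℝ} (hr : 0 < r) (hp : r < p)
    (h : ∀ t : ℝ, 0 < t → t ^ p * P.real {ω | t < ‖Y ω‖} ≤ C) :
    Integrable (fun ω => ‖Y ω‖ ^ r) P := by
  have hC : 0 ≤ C := le_trans (by positivity) (h 1 one_pos)
  have hm : AEMeasurable (fun ω => ‖Y ω‖ ^ r) P := hY.norm.aemeasurable.pow_const r
  have htail : ∀ t : ℝ, 0 < t → P.real {ω | t < ‖Y ω‖ ^ r} ≤ C * t ^ (-(p / r)) := by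
    refine fun t ht => measureReal_lt_le_of_rpow_tail hr (fun u hu => ?_) ht
    simpa only [← Real.rpow_mul (norm_nonneg _), mul_one_div_cancel hr.ne', Real.rpow_one]
      using h u hu
  have hle := setLIntegral_ofReal_le_of_tail P hm ((one_lt_div hr).2 hp) one_pos hC htail Set.univ
  rw [setLIntegral_univ] at hle
  refine ⟨hm.aestronglyMeasurable, ?_⟩
  rw [hasFiniteIntegral_iff_ofReal (Eventually.of_forall fun ω => by positivity)]
  exact hle.trans_lt ENNReal.ofReal_lt_top

section Moments

variable {Ω : Type u} {B : Type v} [NormedAddCommGroup B] [NormedSpace ℝ B] [CompleteSpace B]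
  {mΩ : MeasurableSpace Ω} {P : Measure Ω} {F : Filtration ℕ mΩ} {X : ℕ → Ω → B}

/-- The selecting event is F_{i-1}-measurable, so the conditional moment can replace ‖X_i‖^r on it;
it is contained in {max > l}, which makes the tail at level l reappear. -/
theorem IsMartingaleDiff.lintegral_crossingDiff_le [IsProbabilityMeasure P]
    (hX : IsMartingaleDiff P F X) {r p C l s : ℝ} (hr : 0 < r) (hp : r < p) (hs : 0 < s) {i n : ℕ}
    (hin : i ≤ n) (hint : Integrable (fun ω => ‖X i ω‖ ^ r) P)
    (hC : ∀ t : ℝ, 0 < t →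
      t ^ p * P.real {ω | t < ((P[fun ω' => ‖X i ω'‖ ^ r | F (i - 1)]) ω) ^ (1 / r)} ≤ C) :
    ∫⁻ ω, ‖crossingDiff X l i ω‖ₑ ^ r ∂P ≤
      ENNReal.ofReal (s * P.real {ω | l < (maxNorm X n ω : ℝ)} +
        C * (s ^ (1 - p / r) / (p / r - 1))) := by
  have hC0 : 0 ≤ C := le_trans (by positivity) (hC 1 one_pos)
  have hE := hX.measurableSet_crossingSet l i
  have hE' := F.le _ _ hE
  have hV0 : 0 ≤ᵐ[P] P[fun ω' => ‖X i ω'‖ ^ r | F (i - 1)] :=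
    condExp_nonneg (Eventually.of_forall fun ω => by positivity)
  have hmono : P.real (crossingSet X l i) ≤ P.real {ω | l < (maxNorm X n ω : ℝ)} :=
    measureReal_mono fun ω hω => lt_of_lt_of_le hω.1
      (NNReal.coe_le_coe.2 (maxNorm_mono X ω (show i - 1 ≤ n by omega)))
  calc ∫⁻ ω, ‖crossingDiff X l i ω‖ₑ ^ r ∂P
      = ∫⁻ ω in crossingSet X l i, ENNReal.ofReal (‖X i ω‖ ^ r) ∂P := by
        rw [← lintegral_indicator hE']
        refine lintegral_congr fun ω => ?_
        by_cases h : ω ∈ crossingSet X l i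
        · rw [crossingDiff, Set.indicator_of_mem h, Set.indicator_of_mem h,
            ← ENNReal.ofReal_rpow_of_nonneg (norm_nonneg _) hr.le, ofReal_norm]
        · rw [crossingDiff, Set.indicator_of_notMem h, Set.indicator_of_notMem h, enorm_zero,
            ENNReal.zero_rpow_of_pos hr]
    _ = ENNReal.ofReal (∫ ω in crossingSet X l i, ‖X i ω‖ ^ r ∂P) :=
        (ofReal_integral_eq_lintegral_ofReal hint.integrableOn
          (Eventually.of_forall fun ω => by positivity)).symm
    _ = ENNReal.ofReal
          (∫ ω in crossingSet X l i, (P[fun ω' => ‖X i ω'‖ ^ r | F (i - 1)]) ω ∂P) := by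
        rw [setIntegral_condExp (F.le _) hint hE]
    _ = ∫⁻ ω in crossingSet X l i,
          ENNReal.ofReal ((P[fun ω' => ‖X i ω'‖ ^ r | F (i - 1)]) ω) ∂P :=
        ofReal_integral_eq_lintegral_ofReal integrable_condExp.integrableOn
          (ae_restrict_of_ae hV0)
    _ ≤ _ := setLIntegral_ofReal_le_of_tail P
        integrable_condExp.aestronglyMeasurable.aemeasurable ((one_lt_div hr).2 hp) hs hC0
        (fun t ht => measureReal_lt_le_of_rpow_tail hr hC ht) _
    _ ≤ _ := by gcongr

end Moments

/-! ### Solving the recursion -/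

/-- Halving l multiplies l^(-p) by 2^p. Since A 2^p ≤ 1/2, the bound with factor 2 · 2^p reproduces
itself, and the initial error f ≤ 1 shrinks to A^m after m halvings. -/
theorem le_of_dyadic_recursion {f : ℝ → ℝ} {A b₁ b₂ p₁ p₂ : ℝ} (hf : ∀ l, f l ≤ 1) (hA : 0 ≤ A)
    (hp₁ : 0 < p₁) (hp : p₁ ≤ p₂) (hAp : A * 2 ^ p₂ ≤ 1 / 2) (hb₁ : 0 ≤ b₁) (hb₂ : 0 ≤ b₂)
    (hrec : ∀ l, 0 < l → f (2 * l) ≤ A * f l + b₁ * l ^ (-p₁) + b₂ * l ^ (-p₂))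
    {l : ℝ} (hl : 0 < l) :
    f l ≤ 2 * 2 ^ p₁ * b₁ * l ^ (-p₁) + 2 * 2 ^ p₂ * b₂ * l ^ (-p₂) := by
  have hAp₁ : A * 2 ^ p₁ ≤ 1 / 2 := le_trans (by gcongr; norm_num) hAp
  have hA1 : A < 1 := by
    have : (1 : ℝ) ≤ 2 ^ p₂ := Real.one_le_rpow one_le_two (by linarith)
    nlinarith
  have hhalf : ∀ (p : ℝ) {l : ℝ}, 0 < l → (l / 2) ^ (-p) = 2 ^ p * l ^ (-p) := by
    intro p l hl
    rw [Real.div_rpow hl.le two_pos.le, Real.rpow_neg two_pos.le, div_inv_eq_mul, mul_comm]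
  have key : ∀ (m : ℕ) (l : ℝ), 0 < l →
      f l ≤ A ^ m + (2 * 2 ^ p₁ * b₁ * l ^ (-p₁) + 2 * 2 ^ p₂ * b₂ * l ^ (-p₂)) := by
    intro m
    induction m with
    | zero =>
      intro l hl
      rw [pow_zero]
      have : 0 ≤ 2 * 2 ^ p₁ * b₁ * l ^ (-p₁) + 2 * 2 ^ p₂ * b₂ * l ^ (-p₂) := by positivity
      linarith [hf l]
    | succ m ih =>
      intro l hl
      have h1 := hrec (l / 2) (by linarith)
      rw [mul_div_cancel₀ l two_ne_zero] at h1
      have h2 := mul_le_mul_of_nonneg_left (ih (l / 2) (by linarith)) hA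
      rw [hhalf p₁ hl, hhalf p₂ hl] at h1 h2
      have e₁ : 0 ≤ 2 ^ p₁ * b₁ * l ^ (-p₁) := by positivity
      have e₂ : 0 ≤ 2 ^ p₂ * b₂ * l ^ (-p₂) := by positivity
      have g₁ := mul_le_mul_of_nonneg_right hAp₁ e₁
      have g₂ := mul_le_mul_of_nonneg_right hAp e₂
      rw [pow_succ]
      linarith
  have hlim : Tendsto (fun m : ℕ => A ^ m +
      (2 * 2 ^ p₁ * b₁ * l ^ (-p₁) + 2 * 2 ^ p₂ * b₂ * l ^ (-p₂))) atTop
      (nhds (0 + (2 * 2 ^ p₁ * b₁ * l ^ (-p₁) + 2 * 2 ^ p₂ * b₂ * l ^ (-p₂)))) :=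
    (tendsto_pow_atTop_nhds_zero_of_lt_one hA hA1).add_const _
  rw [zero_add] at hlim
  exact ge_of_tendsto' hlim fun m => key m l hl

/-! ### Comparison with the stated constants -/

theorem one_le_two_rpow_div_sub_one {p : ℝ} (hp : 0 < p) :
    (1 : ℝ) ≤ 2 ^ p / (2 ^ p - 1) := by
  have : (1 : ℝ) < 2 ^ p := Real.one_lt_rpow one_lt_two hp
  rw [one_le_div (by linarith)]
  linarith

/-- One factor 2^p₁ comes from the recursion, the other from the level l/2 in the union bound. Here
D ≥ 1 serves to insert D^(p₁/r). -/
theorem le_constK1 {p₁ p₂ r D : ℝ} (hr : 0 < r) (hD : 1 ≤ D) (hp₁ : r < p₁) (hp : p₁ ≤ p₂) :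
    2 * 2 ^ p₁ * 2 ^ p₁ ≤ constK1 p₁ p₂ r D := by
  have h1 := one_le_two_rpow_div_sub_one (p := 2 * p₂) (by linarith)
  have h2 : (1 : ℝ) ≤ D ^ (p₁ / r) := Real.one_le_rpow hD (by have := hr.trans hp₁; positivity)
  have hq : p₁ * 1 ≤ p₁ * p₂ / r := by
    rw [mul_div_assoc]
    exact mul_le_mul_of_nonneg_left ((one_le_div hr).2 (by linarith)) (by linarith)
  calc (2 : ℝ) * 2 ^ p₁ * 2 ^ p₁ = 2 ^ (1 + p₁ + p₁) := by
        rw [Real.rpow_add two_pos, Real.rpow_add two_pos, Real.rpow_one]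
    _ ≤ 2 ^ ((1 - r) + (p₁ + 2 * p₁ * p₂ / r)) := by
        refine Real.rpow_le_rpow_of_exponent_le one_le_two ?_
        have : 2 * p₁ * p₂ / r = 2 * (p₁ * p₂ / r) := by ring
        linarith
    _ = 1 * 2 ^ (1 - r) * 2 ^ (p₁ + 2 * p₁ * p₂ / r) * 1 := by
        rw [Real.rpow_add two_pos]; ring
    _ ≤ constK1 p₁ p₂ r D := by unfold constK1; gcongr

theorem le_constK2 {p r D : ℝ} (hr : 1 < r) (hD : 0 < D) (hp : r < p) :
    2 * 2 ^ p * (D * 2 ^ r * ((2 ^ (-(p + 1 + r)) / D) ^ (1 - p / r) / (p / r - 1))) ≤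
      constK2 p r D := by
  obtain ⟨q, rfl⟩ : ∃ q, p = r * q := ⟨p / r, by field_simp⟩
  have hr0 : 0 < r := by linarith
  have hq : 1 < q := by nlinarith
  have hqr : r * q / r = q := by field_simp
  have h1 := one_le_two_rpow_div_sub_one (p := 2 * (r * q)) (by positivity)
  have hfrac : r * q / (r * q - r) = q / (q - 1) := by
    rw [show r * q - r = r * (q - 1) by ring, mul_div_mul_left _ _ hr0.ne']
  have h3 : 1 / (q - 1) ≤ (q / (q - 1)) ^ q := by
    have : 1 ≤ q / (q - 1) := (one_le_div (by linarith)).2 (by linarith)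
    calc 1 / (q - 1) ≤ q / (q - 1) := by gcongr
      _ = (q / (q - 1)) ^ (1 : ℝ) := (Real.rpow_one _).symm
      _ ≤ _ := Real.rpow_le_rpow_of_exponent_le this hq.le
  have hσ : (2 ^ (-(r * q + 1 + r)) / D) ^ (1 - q) =
      (2 : ℝ) ^ ((r * q + 1 + r) * (q - 1)) * D ^ (q - 1) := by
    rw [Real.div_rpow (by positivity) hD.le, ← Real.rpow_mul two_pos.le, div_eq_mul_inv,
      ← Real.rpow_neg hD.le]
    rw [neg_sub, show -(r * q + 1 + r) * (1 - q) = (r * q + 1 + r) * (q - 1) by ring]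
  rw [hqr, hσ]
  calc 2 * 2 ^ (r * q) *
        (D * 2 ^ r * (2 ^ ((r * q + 1 + r) * (q - 1)) * D ^ (q - 1) / (q - 1)))
      = 2 ^ (1 + r * q + r + (r * q + 1 + r) * (q - 1)) * D ^ q * (1 / (q - 1)) := by
        rw [Real.rpow_add two_pos, Real.rpow_add two_pos, Real.rpow_add two_pos, Real.rpow_one,
          Real.rpow_sub_one hD.ne']
        field_simp
    _ ≤ 2 ^ ((1 - r) + (r * q + 2 * (r * q) ^ 2 / r)) * D ^ q * (q / (q - 1)) ^ q := by
        have hsq : 2 * (r * q) ^ 2 / r = 2 * r * q ^ 2 := by field_simp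
        -- The right side minus the left is rq(q - 1) + (r - 1)(q - 1).
        have hexp : 1 + r * q + r + (r * q + 1 + r) * (q - 1) ≤
            (1 - r) + (r * q + 2 * (r * q) ^ 2 / r) := by
          rw [hsq]
          nlinarith [mul_pos (mul_pos hr0 (sub_pos.2 hq)) (by linarith : (0 : ℝ) < q),
            mul_pos (sub_pos.2 hr) (sub_pos.2 hq)]
        exact mul_le_mul (mul_le_mul_of_nonneg_right
          (Real.rpow_le_rpow_of_exponent_le one_le_two hexp) (by positivity)) h3
          (one_div_nonneg.2 (by linarith)) (by positivity)
    _ = 1 * 2 ^ (1 - r) * 2 ^ (r * q + 2 * (r * q) ^ 2 / r) * D ^ q * (q / (q - 1)) ^ q := by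
        rw [Real.rpow_add two_pos]; ring
    _ ≤ constK2 (r * q) r D := by
        unfold constK2
        rw [hqr, hfrac]
        have : 0 < q - 1 := by linarith
        gcongr

theorem constK1_nonneg {p₁ p₂ r D : ℝ} (hD : 0 < D) (hp₂ : 0 < p₂) : 0 ≤ constK1 p₁ p₂ r D := by
  have h1 := one_le_two_rpow_div_sub_one (p := 2 * p₂) (by linarith)
  unfold constK1
  positivity

theorem constK2_nonneg {p₂ r D : ℝ} (hD : 0 < D) (hr : 0 < r) (hp₂ : r < p₂) :
    0 ≤ constK2 p₂ r D := by
  have h1 := one_le_two_rpow_div_sub_one (p := 2 * p₂) (by linarith)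
  have h2 : 0 ≤ p₂ / (p₂ - r) := div_nonneg (by linarith) (by linarith)
  unfold constK2
  positivity

theorem isBigO_of_le_rpow_add_rpow {f : ℕ → ℝ} {a b s t : ℝ} (hf : ∀ n, 0 ≤ f n) (ha : 0 ≤ a)
    (hb : 0 ≤ b) (h : ∀ n : ℕ, 1 ≤ n → f n ≤ a * (1 / (n : ℝ) ^ s) + b * (1 / (n : ℝ) ^ t)) :
    f =O[atTop] fun n : ℕ => 1 / (n : ℝ) ^ (min s t) := by
  refine IsBigO.of_bound (a + b) (eventually_atTop.2 ⟨1, fun n hn => ?_⟩)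
  have hn1 : (1 : ℝ) ≤ n := by exact_mod_cast hn
  rw [Real.norm_of_nonneg (hf n), Real.norm_of_nonneg (by positivity), add_mul]
  refine (h n hn).trans ?_
  gcongr <;> simp

/-! ### Tail bound and rate -/

theorem measureReal_mul_lt_maxNorm_le {Ω : Type u} {B : Type v} [NormedAddCommGroup B]
    [NormedSpace ℝ B] [CompleteSpace B] {mΩ : MeasurableSpace Ω} {P : Measure Ω}
    [IsProbabilityMeasure P] {F : Filtration ℕ mΩ} {X : ℕ → Ω → B} {r D : ℝ}
    (hB : IsRDSmooth.{u, v} B r D) {p₁ p₂ : ℝ} (hp₁ : r < p₁) (hp₂ : p₁ ≤ p₂)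
    (hX : IsMartingaleDiff P F X) {C₁ C₂ : ℝ}
    (hC₁ : ∀ i : ℕ, 1 ≤ i → ∀ t : ℝ, 0 < t → t ^ p₁ * P.real {ω | t < ‖X i ω‖} ≤ C₁)
    (hC₂ : ∀ i : ℕ, 1 ≤ i → ∀ t : ℝ, 0 < t →
      t ^ p₂ * P.real {ω | t < ((P[fun ω' => ‖X i ω'‖ ^ r | F (i - 1)]) ω) ^ (1 / r)} ≤ C₂)
    {n : ℕ} (hn : 1 ≤ n) {x : ℝ} (hx : 0 < x) :
    P.real {ω | (n : ℝ) * x < (maxNorm X n ω : ℝ)} ≤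
      constK1 p₁ p₂ r D * C₁ * x ^ (-p₁) * (1 / (n : ℝ) ^ (p₁ - 1)) +
        constK2 p₂ r D * C₂ * x ^ (-p₂) * (1 / (n : ℝ) ^ (p₂ - p₂ / r)) := by
  have hr1 := hB.one_lt
  have hr : 0 < r := by linarith
  have hD := hB.pos
  have hp₂0 : r < p₂ := by linarith
  have hC₁0 : 0 ≤ C₁ := le_trans (by positivity) (hC₁ 1 le_rfl 1 one_pos)
  have hC₂0 : 0 ≤ C₂ := le_trans (by positivity) (hC₂ 1 le_rfl 1 one_pos)
  have hn0 : (0 : ℝ) < n := by exact_mod_cast hn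
  -- D ≥ 1 may fail in the zero space, where the maximum vanishes.
  rcases subsingleton_or_nontrivial B with hsub | hnt
  · have hempty : {ω | (n : ℝ) * x < (maxNorm X n ω : ℝ)} = ∅ := by
      refine Set.eq_empty_of_forall_notMem fun ω hω => ?_
      have h0 : maxNorm X n ω = 0 := by
        simp [maxNorm, Subsingleton.elim _ (0 : B)]
      have hω' : (n : ℝ) * x < (maxNorm X n ω : ℝ) := hω
      rw [h0, NNReal.coe_zero] at hω'
      exact absurd hω' (not_lt.2 (by positivity))
    have hK1 := constK1_nonneg (p₁ := p₁) (r := r) hD (hr.trans hp₂0)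
    have hK2 := constK2_nonneg hD hr hp₂0
    rw [hempty, measureReal_empty]
    positivity
  have hD1 : 1 ≤ D := hB.one_le (P := P) F
  have hq1 : 1 < p₂ / r := (one_lt_div hr).2 hp₂0
  -- With s = l^r σ / n, the coefficient D n s / (l/2)^r of f(l) is 2^(-(p₂ + 1)), the largest the
  -- recursion allows.
  set σ : ℝ := 2 ^ (-(p₂ + 1 + r)) / D with hσ
  have hσ0 : 0 < σ := by positivity
  set c : ℝ := D * 2 ^ r * (σ ^ (1 - p₂ / r) / (p₂ / r - 1)) with hc
  have hc0 : 0 ≤ c := by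
    have : 0 < p₂ / r - 1 := by linarith
    positivity
  have hrec : ∀ l : ℝ, 0 < l → P.real {ω | 2 * l < (maxNorm X n ω : ℝ)} ≤
      2 ^ (-(p₂ + 1)) * P.real {ω | l < (maxNorm X n ω : ℝ)} +
        (n * C₁ * 2 ^ p₁) * l ^ (-p₁) + (c * C₂ * n ^ (p₂ / r)) * l ^ (-p₂) := by
    intro l hl
    have hs : 0 < l ^ r * σ / n := by positivity
    have hb : 0 ≤ l ^ r * σ / n * P.real {ω | l < (maxNorm X n ω : ℝ)} +
        C₂ * ((l ^ r * σ / n) ^ (1 - p₂ / r) / (p₂ / r - 1)) := by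
      have : 0 < p₂ / r - 1 := by linarith
      positivity
    have h := hB.measureReal_two_mul_lt_maxNorm_le hX hn hl hb
      (a := C₁ * (l / 2) ^ (-p₁))
      (fun i hi => by
        have h2 : (0 : ℝ) < l / 2 := by linarith
        rw [Real.rpow_neg h2.le, ← div_eq_mul_inv, le_div_iff₀ (by positivity), mul_comm]
        exact hC₁ i hi _ h2)
      (fun i hi hin => hX.lintegral_crossingDiff_le hr hp₂0 hs hin
        (integrable_norm_rpow_of_tail (hX.integrable i hi).aestronglyMeasurable hr hp₁ (hC₁ i hi))
        (hC₂ i hi))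
    refine h.trans (le_of_eq ?_)
    have e1 : (l / 2) ^ (-p₁) = 2 ^ p₁ * l ^ (-p₁) := by
      rw [Real.div_rpow hl.le two_pos.le, Real.rpow_neg two_pos.le, div_inv_eq_mul, mul_comm]
    have e2 : (l / 2) ^ r = l ^ r / 2 ^ r := Real.div_rpow hl.le two_pos.le _
    have e3 : (l ^ r * σ / n) ^ (1 - p₂ / r) =
        l ^ r * l ^ (-p₂) * σ ^ (1 - p₂ / r) * (n ^ (p₂ / r) / n) := by
      rw [Real.div_rpow (by positivity) hn0.le, Real.mul_rpow (by positivity) hσ0.le,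
        ← Real.rpow_mul hl.le, show r * (1 - p₂ / r) = r + -p₂ by field_simp; ring,
        Real.rpow_add hl, div_eq_mul_inv, ← Real.rpow_neg hn0.le, neg_sub,
        Real.rpow_sub_one hn0.ne']
    have e4 : D * 2 ^ r * σ = 2 ^ (-(p₂ + 1)) := by
      rw [hσ, neg_add (p₂ + 1) r, Real.rpow_add two_pos, Real.rpow_neg two_pos.le r]
      field_simp
    have hlr : 0 < l ^ r := by positivity
    rw [e1, e2, e3, ← e4, hc]
    have : p₂ / r - 1 ≠ 0 := by linarith
    generalize p₂ / r - 1 = w at *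
    field_simp
    ring
  have hfin := le_of_dyadic_recursion (f := fun l => P.real {ω | l < (maxNorm X n ω : ℝ)})
    (fun l => measureReal_le_one) (by positivity) (hr.trans hp₁) hp₂
    (by rw [← Real.rpow_add two_pos]; norm_num [Real.rpow_neg_one])
    (by positivity) (by positivity) hrec (mul_pos hn0 hx)
  have k1 := le_constK1 hr hD1 hp₁ hp₂
  have k2 := le_constK2 hr1 hD hp₂0
  refine hfin.trans ?_
  have x1 : (n * x) ^ (-p₁) * n = x ^ (-p₁) * (1 / (n : ℝ) ^ (p₁ - 1)) := by
    rw [Real.mul_rpow hn0.le hx.le, Real.rpow_sub_one hn0.ne', Real.rpow_neg hn0.le]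
    field_simp
  have x2 : (n * x) ^ (-p₂) * n ^ (p₂ / r) = x ^ (-p₂) * (1 / (n : ℝ) ^ (p₂ - p₂ / r)) := by
    rw [Real.mul_rpow hn0.le hx.le, Real.rpow_sub hn0, Real.rpow_neg hn0.le]
    field_simp
  calc _ = 2 * 2 ^ p₁ * 2 ^ p₁ * C₁ * ((n * x) ^ (-p₁) * n) +
        2 * 2 ^ p₂ * c * C₂ * ((n * x) ^ (-p₂) * n ^ (p₂ / r)) := by ring
    _ ≤ constK1 p₁ p₂ r D * C₁ * ((n * x) ^ (-p₁) * n) +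
        constK2 p₂ r D * C₂ * ((n * x) ^ (-p₂) * n ^ (p₂ / r)) := by gcongr
    _ = _ := by rw [x1, x2]; ring

theorem theorem2 {B : Type v} [NormedAddCommGroup B] [NormedSpace ℝ B] [CompleteSpace B]
    [TopologicalSpace.SeparableSpace B] {r D : ℝ} (hB : IsRDSmooth.{u, v} B r D)
    {p₁ p₂ : ℝ} (hp₁ : r < p₁) (hp₂ : p₁ ≤ p₂)
    {Ω : Type u} {mΩ : MeasurableSpace Ω} (P : Measure Ω) [IsProbabilityMeasure P]
    (F : Filtration ℕ mΩ) (X : ℕ → Ω → B) (hX : IsMartingaleDiff P F X) {C₁ C₂ : ℝ}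
    (hC₁ : ∀ i : ℕ, 1 ≤ i → ∀ t : ℝ, 0 < t → t ^ p₁ * P.real {ω | t < ‖X i ω‖} ≤ C₁)
    (hC₂ : ∀ i : ℕ, 1 ≤ i → ∀ t : ℝ, 0 < t →
      t ^ p₂ * P.real {ω | t < ((P[fun ω' => ‖X i ω'‖ ^ r | F (i - 1)]) ω) ^ (1 / r)} ≤ C₂) :
    (∀ n : ℕ, 1 ≤ n → ∀ x : ℝ, 0 < x →
      P.real {ω | (n : ℝ) * x < (maxNorm X n ω : ℝ)} ≤
        constK1 p₁ p₂ r D * C₁ * x ^ (-p₁) * (1 / (n : ℝ) ^ (p₁ - 1)) +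
          constK2 p₂ r D * C₂ * x ^ (-p₂) * (1 / (n : ℝ) ^ (p₂ - p₂ / r))) ∧
    (fun n : ℕ => P.real {ω | (n : ℝ) < (maxNorm X n ω : ℝ)}) =O[atTop]
      fun n : ℕ => 1 / (n : ℝ) ^ (min (p₁ - 1) (p₂ - p₂ / r)) := by
  have hr : 0 < r := by linarith [hB.one_lt]
  have hbound : ∀ n : ℕ, 1 ≤ n → ∀ x : ℝ, 0 < x → _ := fun n hn x hx =>
    measureReal_mul_lt_maxNorm_le hB hp₁ hp₂ hX hC₁ hC₂ hn hx
  refine ⟨hbound, ?_⟩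
  have hC₁0 : 0 ≤ C₁ := le_trans (by positivity) (hC₁ 1 le_rfl 1 one_pos)
  have hC₂0 : 0 ≤ C₂ := le_trans (by positivity) (hC₂ 1 le_rfl 1 one_pos)
  refine isBigO_of_le_rpow_add_rpow (fun n => measureReal_nonneg)
    (mul_nonneg (constK1_nonneg (p₁ := p₁) (r := r) hB.pos (by linarith : 0 < p₂)) hC₁0)
    (mul_nonneg (constK2_nonneg hB.pos hr (by linarith : r < p₂)) hC₂0) fun n hn => ?_
  simpa only [mul_one, Real.one_rpow] using hbound n hn 1 one_pos
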